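/- Consider the scalar delay differential equation $$\dot x(t)+\sum_{k=1}^m a_k(t)\,x(h_k(t))=0,\qquad t\ge t_0, \tag{1}$$ where the $a_k$ are Lebesgue measurable, essentially bounded functions on $[0,\infty)$ and the $h_k$ are Lebesgue measurable functions with $h_k(t)\le t$. For $t_0\ge 0$, $x_0\in\mathbb R$ and a bounded Borel measurable function $\varphi:(-\infty,t_0)\to\mathbb R$, a solution of (1) with $x(t)=\varphi(t)$ for $t<t_0$ and $x(t_0)=x_0$ is a function $x:\mathbb R\to\mathbb R$ that satisfies these initial conditions, is locally absolutely continuous on $[t_0,\infty)$ and satisfies (1) for almost all $t\ge t_0$. Equation (1) is called (uniformly) exponentially stable if there are $M>0$ and $\mu>0$, independent of $t_0$, $\varphi$ and $x_0$, such that every such solution satisfies $$|x(t)|\le M e^{-\mu(t-t_0)}\Bigl(|x(t_0)|+\sup_{s<t_0}|\varphi(s)|\Bigr),\qquad t\ge t_0 .$$ Suppose that $a_k(t)\ge 0$ for all $k$, that $$\liminf_{t\to\infty}\sum_{k=1}^m a_k(t)>0,\qquad \limsup_{t\to\infty}\,(t-h_k(t))<\infty\quad (k=1,\dots,m),$$ and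 that $$\limsup_{t\to\infty}\ \sum_{k=1}^m\frac{a_k(t)}{\sum_{i=1}^m a_i(t)}\int_{h_k(t)}^t\sum_{i=1}^m a_i(s)\,ds<1+\frac1e .$$ Then equation (1) is exponentially stable. (Here pointwise inequalities are only required almost everywhere, and $\liminf$, $\limsup$ are the essential ones, i.e. null sets of $t$ are disregarded; in particular the result holds when the conditions hold pointwise.) -/

import Mathlib

open Filter MeasureTheory Set

noncomputable section

namespace DelayEquation

/-- `IsSolution a h t₀ φ x₀ x`: the function `x : ℝ → ℝ` is a solution of the initial value problem
`x'(t) + ∑ₖ aₖ(t) x(hₖ(t)) = 0` for `t ≥ t₀`, `x(t) = φ(t)` for `t < t₀`, `x(t₀) = x₀`.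
It is locally absolutely continuous on `[t₀, ∞)` and satisfies the equation almost everywhere there. -/
structure IsSolution {m : ℕ} (a h : Fin m → ℝ → ℝ) (t₀ : ℝ) (φ : Iio t₀ → ℝ) (x₀ : ℝ)
    (x : ℝ → ℝ) : Prop where
  history : ∀ t : Iio t₀, x t = φ t
  initial : x t₀ = x₀
  absCont : ∀ T, t₀ ≤ T → AbsolutelyContinuousOnInterval x t₀ T
  equation : ∀ᵐ t ∂(volume.restrict (Ici t₀)), HasDerivAt x (-∑ k, a k t * x (h k t)) t

/-- (Uniform) exponential stability of `x'(t) + ∑ₖ aₖ(t) x(hₖ(t)) = 0`: every solution of every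
initial value problem, with initial point `t₀ ≥ 0` and bounded Borel measurable initial function
`φ` on `(-∞, t₀)`, satisfies an exponential estimate, with constants independent of `t₀`, of the
initial data and of the solution. -/
def ExponentiallyStable {m : ℕ} (a h : Fin m → ℝ → ℝ) : Prop :=
  ∃ M > 0, ∃ μ > 0, ∀ t₀ : ℝ, 0 ≤ t₀ → ∀ φ : Iio t₀ → ℝ, Measurable φ →
    (∃ C, ∀ s, |φ s| ≤ C) → ∀ (x₀ : ℝ) (x : ℝ → ℝ), IsSolution a h t₀ φ x₀ x →
      ∀ t, t₀ ≤ t → |x t| ≤ M * Real.exp (-μ * (t - t₀)) * (|x₀| + ⨆ s, |φ s|)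

/-- The filter of neighbourhoods of `+∞` up to Lebesgue null sets. The `limsup` and `liminf` along
it are the essential ones as `t → ∞`; they do not see changes of a function on a null set. -/
def essAtTop : Filter ℝ := atTop ⊓ ae volume

end DelayEquation

end

/-! Measure time by the integral `A` of the coefficients. A solution with `|x| ≤ 1` then has slope
at most 1, and its average delay is at most `τ = 171/125`, slightly above `1 + 1/e`. The core is an
overshoot estimate: once such a solution has been nonpositive, it stays below `999/1000`.

Up to the height `τ - 1 = 46/125` only slope 1 is used. Above it, if every chord of the graph ending
at time `t` has slope at most `K`, then `x (h k t) ≥ x t - K * (A t - A (h k t))`, and averaging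
over `k` bounds the slope at `t` by `τ K - x t`. Since this falls as `x` climbs, `K` may decrease
with the height. A decreasing `K` is self-consistent if it satisfies the differential inequality
`slopeBound_mul_le`; `slopeBound` is an explicit polynomial doing so, which moreover makes `τ K - x`
nonpositive for `x` from `999/1000` to 1. A barrier argument (`RegularFrom.chord_le`) turns this
into the overshoot estimate.

A solution that stays positive decreases instead, at a rate controlled by the lower bound `α` of the
coefficient sum. In either case, and likewise for `-x`, a bound shrinks by the factor `999/1000`
over a time `4 * H + 2 / α`, and iteration gives exponential decay. A growth estimate covers the
initial stretch. -/

noncomputable section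

namespace DelayEquation

/-! ### Polynomial inequalities for the slope bound -/

/-- Upper bound, as a function of `w = x(t) - 46 / 125`, for the slopes of the chords of a solution
bounded by `1` that end at `(t, x(t))`, time being measured by the integral of the coefficients. -/
def slopeBound (w : ℝ) : ℝ := 1 - w ^ 2 * (1 / 3 + 2 / 5 * w - 4 / 3 * w ^ 2 + 5 / 2 * w ^ 3)

/-- The negative of the derivative of `slopeBound`. -/
def slopeDecay (w : ℝ) : ℝ := 2 / 3 * w + 6 / 5 * w ^ 2 - 16 / 3 * w ^ 3 + 25 / 2 * w ^ 4

theorem hasDerivAt_slopeBound (w : ℝ) : HasDerivAt slopeBound (-slopeDecay w) w := by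
  have h1 : HasDerivAt (fun w : ℝ => w) 1 w := hasDerivAt_id w
  have := (((h1.fun_pow 2).fun_mul ((((h1.const_mul (2 / 5)).const_add (1 / 3)).fun_sub
    ((h1.fun_pow 2).const_mul (4 / 3))).fun_add ((h1.fun_pow 3).const_mul (5 / 2)))).const_sub 1)
  unfold slopeBound slopeDecay
  convert! this using 1
  norm_num
  ring

theorem slopeBound_zero : slopeBound 0 = 1 := by simp [slopeBound]

theorem continuous_slopeBound : Continuous slopeBound := by unfold slopeBound; fun_prop

/-- Positivity of a polynomial from its Bernstein coefficients on three subintervals. -/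
theorem slopeBound_bernstein {w : ℝ} (hw0 : 0 ≤ w) (hw1 : w ≤ 79 / 125) :
    0 ≤ (11/125) * w ^ 0 + (-796/625) * w ^ 1 + (404719/46875) * w ^ 2 +
      (-4849483/281250) * w ^ 3 + (-2060524/1171875) * w ^ 4 + (15759649/1406250) * w ^ 5 +
      (966603/31250) * w ^ 6 + (-1036714/28125) * w ^ 7 + (29843/1500) * w ^ 8 +
      (809/20) * w ^ 9 := by
  have key : ∀ l r : ℝ, l ≤ w → w ≤ r → 0 ≤ w - l ∧ 0 ≤ r - w := fun l r h1 h2 =>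
    ⟨by linarith, by linarith⟩
  rcases le_total w (3/10) with h1 | h1
  · obtain ⟨hl, hr⟩ := key (0) (3/10) (by linarith) (by linarith)
    refine le_of_le_of_eq (?_ : 0 ≤ 88000000/19683 * ((w - 0) ^ 0 * (3/10 - w) ^ 9) +
      136640000/6561 * ((w - 0) ^ 1 * (3/10 - w) ^ 8) +
      296140160/6561 * ((w - 0) ^ 2 * (3/10 - w) ^ 7) +
      555877664/6561 * ((w - 0) ^ 3 * (3/10 - w) ^ 6) +
      133426897088/820125 * ((w - 0) ^ 4 * (3/10 - w) ^ 5) +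
      188011760168/820125 * ((w - 0) ^ 5 * (3/10 - w) ^ 4) +
      53759522636/273375 * ((w - 0) ^ 6 * (3/10 - w) ^ 3) +
      15711103652/164025 * ((w - 0) ^ 7 * (3/10 - w) ^ 2) +
      39335769791/1640250 * ((w - 0) ^ 8 * (3/10 - w) ^ 1) +
      23504690237/9841500 * ((w - 0) ^ 9 * (3/10 - w) ^ 0)) (by ring)
    positivity
  rcases le_total w (1/2) with h2 | h2
  · obtain ⟨hl, hr⟩ := key (3/10) (1/2) (by linarith) (by linarith)
    refine le_of_le_of_eq (?_ : 0 ≤ 23504690237/256000 * ((w - 3/10) ^ 0 * (1/2 - w) ^ 9) +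
      195227274391/256000 * ((w - 3/10) ^ 1 * (1/2 - w) ^ 8) +
      20145721967/7680 * ((w - 3/10) ^ 2 * (1/2 - w) ^ 7) +
      2739109116811/576000 * ((w - 3/10) ^ 3 * (1/2 - w) ^ 6) +
      1814902523129/384000 * ((w - 3/10) ^ 4 * (1/2 - w) ^ 5) +
      2695250940377/1152000 * ((w - 3/10) ^ 5 * (1/2 - w) ^ 4) +
      5105447477/12800 * ((w - 3/10) ^ 6 * (1/2 - w) ^ 3) +
      3060056959/23040 * ((w - 3/10) ^ 7 * (1/2 - w) ^ 2) +
      494733737/2048 * ((w - 3/10) ^ 8 * (1/2 - w) ^ 1) +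
      560889665/6144 * ((w - 3/10) ^ 9 * (1/2 - w) ^ 0)) (by ring)
    positivity
  obtain ⟨hl, hr⟩ := key (1/2) (79/125) (by linarith) (by linarith)
  refine le_of_le_of_eq (?_ : 0 ≤ 2139624271392822265625/556937812823436 * ((w - 1/2) ^ 0 * (79/125
      - w) ^ 9) +
      261381601257324218750/5156831600217 * ((w - 1/2) ^ 1 * (79/125 - w) ^ 8) +
      13665479543574218750000/46411484401953 * ((w - 1/2) ^ 2 * (79/125 - w) ^ 7) +
      45573516278277460937500/46411484401953 * ((w - 1/2) ^ 3 * (79/125 - w) ^ 6) +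
      31999846592578891250000/15470494800651 * ((w - 1/2) ^ 4 * (79/125 - w) ^ 5) +
      132538686545974325200000/46411484401953 * ((w - 1/2) ^ 5 * (79/125 - w) ^ 4) +
      40035416257545582532000/15470494800651 * ((w - 1/2) ^ 6 * (79/125 - w) ^ 3) +
      23002047950901788750720/15470494800651 * ((w - 1/2) ^ 7 * (79/125 - w) ^ 2) +
      22848157629966632715968/46411484401953 * ((w - 1/2) ^ 8 * (79/125 - w) ^ 1) +
      49904228034027225520384/696172266029295 * ((w - 1/2) ^ 9 * (79/125 - w) ^ 0)) (by ring)
  positivity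

/-- Self-consistency of the slope bound `K`: the slope is at most `L = 171/125 * K - x`, and a chord
violating the bound has length `Δ` with `K * Δ ≤ w + 171/125`, so this is what yields `L * (1 +
slopeDecay w * Δ) ≤ K`. Equality holds at `w = 0`, whence the factor `w` in the proof. -/
theorem slopeBound_mul_le {w : ℝ} (hw0 : 0 ≤ w) (hw1 : w ≤ 79 / 125) :
    (171 / 125 * slopeBound w - (w + 46 / 125)) *
      (slopeBound w + slopeDecay w * (w + 171 / 125)) ≤ slopeBound w ^ 2 := by
  have := mul_nonneg hw0 (slopeBound_bernstein hw0 hw1)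
  unfold slopeBound slopeDecay
  linarith

theorem slopeDecay_nonneg {w : ℝ} (hw0 : 0 ≤ w) : 0 ≤ slopeDecay w := by
  have : slopeDecay w = w * (2 / 3 + w * ((6 / 5 - 128 / 225) + 25 / 2 * (w - 16 / 75) ^ 2)) := by
    unfold slopeDecay; ring
  have h2 : 0 ≤ w * (2 / 3 + w * ((6 / 5 - 128 / 225) + 25 / 2 * (w - 16 / 75) ^ 2)) := by
    have : (0 : ℝ) ≤ 6 / 5 - 128 / 225 := by norm_num
    positivity
  linarith

theorem slopeDecay_le {w : ℝ} (hw0 : 0 ≤ w) (hw1 : w ≤ 79 / 125) : slopeDecay w ≤ 3 := by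
  have h2 : w ^ 2 ≤ (79 / 125) ^ 2 := by gcongr
  have h3 : 0 ≤ w ^ 3 := by positivity
  have h4 : w ^ 4 ≤ (79 / 125) ^ 4 := by gcongr
  unfold slopeDecay
  linarith

theorem half_le_slopeBound {w : ℝ} (hw0 : 0 ≤ w) (hw1 : w ≤ 79 / 125) : 1 / 2 ≤ slopeBound w := by
  have h2 : w ^ 2 ≤ (79 / 125) ^ 2 := by gcongr
  have h3 : w ^ 3 ≤ (79 / 125) ^ 3 := by gcongr
  have h4 : 0 ≤ w ^ 4 := by positivity
  have h5 : w ^ 5 ≤ (79 / 125) ^ 5 := by gcongr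
  unfold slopeBound
  linarith

/-- Here `w + 46/125 = x` runs from `999/1000` to 1: at these heights the solution can no longer
increase. -/
theorem slopeBound_le_of_ge {w : ℝ} (hw0 : 631 / 1000 ≤ w) (hw1 : w ≤ 79 / 125) :
    171 / 125 * slopeBound w ≤ w + 46 / 125 := by
  have h2 : (631 / 1000) ^ 2 ≤ w ^ 2 := by gcongr
  have h3 : (631 / 1000) ^ 3 ≤ w ^ 3 := by gcongr
  have h4 : w ^ 4 ≤ (79 / 125) ^ 4 := by gcongr
  have h5 : (631 / 1000) ^ 5 ≤ w ^ 5 := by gcongr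
  unfold slopeBound
  linarith

/-! ### Real analysis: monotonicity, first and last times, composition -/

/-- An absolutely continuous function with nonpositive derivative almost everywhere decreases. -/
theorem le_of_ae_hasDerivAt_nonpos {f : ℝ → ℝ} {a b : ℝ} (hab : a ≤ b)
    (hf : AbsolutelyContinuousOnInterval f a b)
    (hf' : ∀ᵐ t, t ∈ Ioo a b → ∃ d ≤ 0, HasDerivAt f d t) : f b ≤ f a := by
  have h1 := hf.integral_deriv_eq_sub
  have h2 : ∫ t in a..b, deriv f t ≤ 0 := by
    rw [intervalIntegral.integral_of_le hab, integral_Ioc_eq_integral_Ioo]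
    refine integral_nonpos_of_ae ?_
    filter_upwards [(ae_restrict_iff' measurableSet_Ioo).2 hf'] with t ⟨d, hd, h⟩
    simpa [h.deriv] using hd
  linarith

/-- The last point of `[a, b]` at which a continuous function is at most `c`. -/
theorem exists_last_le {f : ℝ → ℝ} {a b c : ℝ} (hab : a ≤ b) (hf : ContinuousOn f (Icc a b))
    (ha : f a ≤ c) (hb : c < f b) : ∃ z ∈ Ico a b, f z = c ∧ ∀ t ∈ Ioc z b, c < f t := by
  have hS : IsCompact (Icc a b ∩ f ⁻¹' Iic c) :=
    isCompact_Icc.of_isClosed_subset (hf.preimage_isClosed_of_isClosed isClosed_Icc isClosed_Iic)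
      inter_subset_left
  obtain ⟨z, ⟨⟨hz1, hz2⟩, hzc : f z ≤ c⟩, hmax⟩ := hS.exists_isMaxOn ⟨a, ⟨le_rfl, hab⟩, ha⟩
    continuousOn_id
  have hlast : ∀ t ∈ Ioc z b, c < f t := by
    intro t ht
    by_contra! hcon
    have h3 : t ≤ z := hmax ⟨⟨hz1.trans ht.1.le, ht.2⟩, hcon⟩
    exact absurd ht.1 h3.not_gt
  have hzb : z < b := lt_of_le_of_ne hz2 (by rintro rfl; linarith)
  refine ⟨z, ⟨hz1, hzb⟩, le_antisymm hzc ?_, hlast⟩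
  by_contra! hcon
  obtain ⟨y, hy, hyc⟩ := intermediate_value_Ioc hz2 (hf.mono (Icc_subset_Icc_left hz1))
    (show c ∈ Ioc (f z) (f b) from ⟨hcon, hb.le⟩)
  exact absurd hyc (hlast y hy).ne'

/-- The first point of `[a, b]` at which a continuous function exceeds another one. -/
theorem exists_first_ge {f g : ℝ → ℝ} {a b : ℝ} (hab : a ≤ b) (hf : ContinuousOn f (Icc a b))
    (hg : ContinuousOn g (Icc a b)) (hb : g b ≤ f b) :
    ∃ z ∈ Icc a b, g z ≤ f z ∧ ∀ t ∈ Ico a z, f t < g t := by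
  have hS : IsCompact (Icc a b ∩ (fun t => f t - g t) ⁻¹' Ici 0) :=
    isCompact_Icc.of_isClosed_subset
      ((hf.sub hg).preimage_isClosed_of_isClosed isClosed_Icc isClosed_Ici) inter_subset_left
  obtain ⟨z, ⟨⟨hz1, hz2⟩, hzc⟩, hmin⟩ := hS.exists_isMinOn
    ⟨b, ⟨hab, le_rfl⟩, by simpa using hb⟩ continuousOn_id
  refine ⟨z, ⟨hz1, hz2⟩, by simpa using hzc, fun t ht => ?_⟩
  by_contra! hcon
  have h3 : z ≤ t := hmin ⟨⟨ht.1, ht.2.le.trans hz2⟩, by simpa using hcon⟩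
  exact absurd ht.2 h3.not_gt

/-- The composition of an absolutely continuous function with a `C¹` one is absolutely continuous.
      -/
theorem absolutelyContinuous_comp {f g : ℝ → ℝ} {a b : ℝ} (hg : ContDiff ℝ 1 g)
    (hf : AbsolutelyContinuousOnInterval f a b) :
    AbsolutelyContinuousOnInterval (fun t => g (f t)) a b := by
  obtain ⟨C, hC⟩ := hf.exists_bound
  obtain ⟨K, hK⟩ := (hg.contDiffOn (s := Icc (-C) C)).exists_lipschitzOnWith (by decide)
    (convex_Icc _ _) isCompact_Icc
  have hmem : ∀ x ∈ uIcc a b, f x ∈ Icc (-C) C := fun x hx => abs_le.1 (hC x hx)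
  unfold AbsolutelyContinuousOnInterval at hf ⊢
  refine squeeze_zero' (Eventually.of_forall fun E => Finset.sum_nonneg fun i _ => dist_nonneg) ?_
    (by simpa using hf.const_mul (K : ℝ))
  have h1 : ∀ᶠ E in AbsolutelyContinuousOnInterval.totalLengthFilter ⊓
      𝓟 (AbsolutelyContinuousOnInterval.disjWithin a b),
      E ∈ AbsolutelyContinuousOnInterval.disjWithin a b :=
    eventually_inf_principal.2 (Eventually.of_forall fun _ h => h)
  filter_upwards [h1] with E hE
  rw [Finset.mul_sum]
  refine Finset.sum_le_sum fun i hi => ?_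
  exact hK.dist_le_mul _ (hmem _ (hE.1 i hi).1) _ (hmem _ (hE.1 i hi).2)


/-! ### Coefficients and solutions from a given time on -/

/-- The properties of the coefficients from the time `T` on: `A` is an antiderivative of their sum,
the sum is at least `α`, the delays are at most `H`, and `171 / 125`, which is slightly more than
`1 + 1 / e`, bounds the average delay measured by `A`. -/
structure RegularFrom {m : ℕ} (a h : Fin m → ℝ → ℝ) (A : ℝ → ℝ) (α H T : ℝ) : Prop where
  pos : 0 < α
  delay_nonneg : 0 ≤ H
  absCont : ∀ s t, T ≤ s → s ≤ t → AbsolutelyContinuousOnInterval A s t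
  mono : MonotoneOn A (Ici T)
  ae : ∀ᵐ t, T ≤ t → HasDerivAt A (∑ k, a k t) t ∧ α ≤ ∑ k, a k t ∧
    (∀ k, 0 ≤ a k t ∧ t - H ≤ h k t ∧ h k t ≤ t) ∧
    ∑ k, a k t * (A t - A (h k t)) ≤ 171 / 125 * ∑ k, a k t

/-- `x` is locally absolutely continuous on `[s, ∞)` and satisfies the equation there. -/
structure SolvesFrom {m : ℕ} (a h : Fin m → ℝ → ℝ) (x : ℝ → ℝ) (s : ℝ) : Prop where
  absCont : ∀ t, s ≤ t → AbsolutelyContinuousOnInterval x s t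
  ae : ∀ᵐ t, s ≤ t → HasDerivAt x (-∑ k, a k t * x (h k t)) t

variable {m : ℕ} {a h : Fin m → ℝ → ℝ} {A x : ℝ → ℝ} {α H T s t : ℝ}

theorem SolvesFrom.const_mul (hx : SolvesFrom a h x s) (c : ℝ) :
    SolvesFrom a h (fun t => c * x t) s := by
  refine ⟨fun t ht => (hx.absCont t ht).const_mul c, ?_⟩
  filter_upwards [hx.ae] with t h1 h2
  convert! (h1 h2).const_mul c using 1
  rw [mul_neg, Finset.mul_sum]
  congr 1
  exact Finset.sum_congr rfl fun k _ => by ring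

theorem SolvesFrom.neg (hx : SolvesFrom a h x s) : SolvesFrom a h (fun t => -x t) s := by
  simpa using hx.const_mul (-1)

theorem SolvesFrom.mono (hx : SolvesFrom a h x s) {s' : ℝ} (hs : s ≤ s') :
    SolvesFrom a h x s' := by
  refine ⟨fun t ht => (hx.absCont t (hs.trans ht)).mono ?_, ?_⟩
  · rw [uIcc_of_le ht, uIcc_of_le (hs.trans ht)]
    exact Icc_subset_Icc_left hs
  · filter_upwards [hx.ae] with t h1 h2 using h1 (hs.trans h2)

theorem SolvesFrom.absCont' (hx : SolvesFrom a h x s) {b c : ℝ} (hb : s ≤ b) (hbc : b ≤ c) :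
    AbsolutelyContinuousOnInterval x b c :=
  (hx.mono hb).absCont c hbc

theorem SolvesFrom.continuousOn (hx : SolvesFrom a h x s) {b c : ℝ} (hb : s ≤ b) :
    ContinuousOn x (Icc b c) := by
  rcases le_total b c with hbc | hbc
  · simpa [uIcc_of_le hbc] using (hx.absCont' hb hbc).continuousOn
  · exact (continuousOn_singleton x b).mono fun y hy =>
      le_antisymm (hy.2.trans hbc) hy.1

theorem RegularFrom.continuousOn (hA : RegularFrom a h A α H T) {b c : ℝ} (hb : T ≤ b) :
    ContinuousOn A (Icc b c) := by
  rcases le_total b c with hbc | hbc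
  · simpa [uIcc_of_le hbc] using (hA.absCont b c hb hbc).continuousOn
  · exact (continuousOn_singleton A b).mono fun y hy =>
      le_antisymm (hy.2.trans hbc) hy.1

/-- A solution bounded by `V` grows at most `V` times as fast as the integral of the coefficients.
      -/
theorem RegularFrom.sub_le (hA : RegularFrom a h A α H T) {V : ℝ} (hx : SolvesFrom a h x s)
    (hT : T ≤ s) (hst : s ≤ t) (hV : ∀ r ∈ Icc (s - H) t, |x r| ≤ V) :
    x t - x s ≤ V * (A t - A s) := by
  have := le_of_ae_hasDerivAt_nonpos (f := fun r => x r - V * A r) hst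
    ((hx.absCont t hst).fun_sub ((hA.absCont s t hT hst).const_mul V)) ?_
  · linarith
  filter_upwards [hA.ae, hx.ae] with r h1 h2 hr
  obtain ⟨hd, -, hk, -⟩ := h1 (hT.trans hr.1.le)
  refine ⟨_, ?_, (h2 hr.1.le).fun_sub (hd.const_mul V)⟩
  rw [Finset.mul_sum, ← Finset.sum_neg_distrib, ← Finset.sum_sub_distrib]
  refine Finset.sum_nonpos fun k _ => ?_
  have h4 := abs_le.1 (hV (h k r) ⟨by linarith [(hk k).2.1, hr.1], (hk k).2.2.trans hr.2.le⟩)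
  nlinarith [(hk k).1]

/-! ### The chord estimate and the overshoot bound -/

/-- The derivative of the chord excess minus a barrier `W` with derivative `13 * S * W`. As `K ≥
1/2` and `K * Δ ≤ 2`, one has `Δ ≤ 4`; with `slopeDecay ≤ 3` the error `W` in the slope is amplified
by at most `1 + 3 * 4 = 13`. -/
theorem chord_derivative_nonpos {w W S X Δ : ℝ} (hw0 : 0 ≤ w) (hw1 : w ≤ 79 / 125) (hW : 0 ≤ W)
    (hS : 0 ≤ S) (hΔ : 0 ≤ Δ) (hKΔ : slopeBound w * Δ ≤ w + 171 / 125)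
    (hX : X ≤ S * (171 / 125 * slopeBound w - (w + 46 / 125) + W)) :
    X * (1 + slopeDecay w * Δ) - slopeBound w * S - 13 * (S * W) ≤ 0 := by
  have hD := slopeDecay_nonneg hw0
  have hD3 := slopeDecay_le hw0 hw1
  have hK := half_le_slopeBound hw0 hw1
  have hP := slopeBound_mul_le hw0 hw1
  set K := slopeBound w
  set D := slopeDecay w
  set L := 171 / 125 * K - (w + 46 / 125) with hL
  have hDΔ : 0 ≤ D * Δ := by positivity
  have hΔ4 : Δ ≤ 4 := by nlinarith
  have hE13 : 1 + D * Δ ≤ 13 := by nlinarith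
  have hKE : K * (1 + D * Δ) ≤ K + D * (w + 171 / 125) := by nlinarith
  have hLE : L * (1 + D * Δ) ≤ K := by
    rcases le_total L 0 with h0 | h0
    · nlinarith
    · have : K * (L * (1 + D * Δ)) ≤ K * K := by nlinarith
      exact le_of_mul_le_mul_left this (by linarith)
  have h1 : X * (1 + D * Δ) ≤ S * (L + W) * (1 + D * Δ) :=
    mul_le_mul_of_nonneg_right hX (by linarith)
  have h2 : S * ((L + W) * (1 + D * Δ)) ≤ S * (K + 13 * W) := by
    refine mul_le_mul_of_nonneg_left ?_ hS
    nlinarith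
  linarith

/-- The amount by which a chord of `x` is steeper than allowed by `slopeBound`. -/
def chordExcess (x A : ℝ → ℝ) (t s : ℝ) : ℝ :=
  x t - x s - slopeBound (x t - 46 / 125) * (A t - A s)

theorem chordExcess_continuousOn {Q : Set (ℝ × ℝ)} {I : Set ℝ} (hx : ContinuousOn x I)
    (hA : ContinuousOn A I) (h1 : MapsTo Prod.fst Q I) (h2 : MapsTo Prod.snd Q I) :
    ContinuousOn (fun p : ℝ × ℝ => chordExcess x A p.1 p.2) Q := by
  have hx1 : ContinuousOn (fun p : ℝ × ℝ => x p.1) Q := hx.comp continuousOn_fst h1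
  have hx2 : ContinuousOn (fun p : ℝ × ℝ => x p.2) Q := hx.comp continuousOn_snd h2
  have hA1 : ContinuousOn (fun p : ℝ × ℝ => A p.1) Q := hA.comp continuousOn_fst h1
  have hA2 : ContinuousOn (fun p : ℝ × ℝ => A p.2) Q := hA.comp continuousOn_snd h2
  have hS := continuous_slopeBound
  unfold chordExcess
  fun_prop

theorem chordExcess_absolutelyContinuous {b c : ℝ} (hx : AbsolutelyContinuousOnInterval x b c)
    (hA : AbsolutelyContinuousOnInterval A b c) (s : ℝ) :
    AbsolutelyContinuousOnInterval (fun t => chordExcess x A t s) b c := by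
  have hcst : ∀ y : ℝ, AbsolutelyContinuousOnInterval (fun _ => y) b c := fun y =>
    absolutelyContinuous_comp (g := fun _ => y) contDiff_const hx
  have hg : ContDiff ℝ 1 fun v => slopeBound (v - 46 / 125) := by unfold slopeBound; fun_prop
  exact (hx.fun_sub (hcst _)).fun_sub
    ((absolutelyContinuous_comp hg hx).fun_mul (hA.fun_sub (hcst _)))

theorem chordExcess_hasDerivAt {X S : ℝ} (hx : HasDerivAt x X t) (hA : HasDerivAt A S t) (s : ℝ) :
    HasDerivAt (fun t => chordExcess x A t s)
      (X * (1 +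
      slopeDecay (x t - 46 / 125) * (A t - A s)) - slopeBound (x t - 46 / 125) * S) t := by
  have hK : HasDerivAt (fun t => slopeBound (x t - 46 / 125))
      (-slopeDecay (x t - 46 / 125) * X) t :=
    HasDerivAt.comp (h₂ := slopeBound) (h := fun t => x t - 46 / 125) t
      (hasDerivAt_slopeBound (x t - 46 / 125)) (hx.sub_const (46 / 125))
  convert! (hx.sub_const (x s)).fun_sub (hK.fun_mul (hA.sub_const (A s))) using 1
  ring

/-- From the point on where a solution bounded by `1` exceeds `46 / 125`, its chords have slopes
bounded by `slopeBound`. -/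
theorem RegularFrom.chord_le (hA : RegularFrom a h A α H T) {z t₁ : ℝ}
    (hx : SolvesFrom a h x (z - H)) (hT : T ≤ z - H)
    (hV : ∀ r ∈ Icc (z - 2 * H) t₁, |x r| ≤ 1) (hz : x z = 46 / 125)
    (hzt : ∀ r ∈ Icc z t₁, 46 / 125 ≤ x r) (ht : t ∈ Icc z t₁) (hs : s ∈ Icc (z - H) t) :
    x t - x s ≤ slopeBound (x t - 46 / 125) * (A t - A s) := by
  have hH := hA.delay_nonneg
  have hxc : ContinuousOn x (Icc (z - H) t₁) := hx.continuousOn le_rfl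
  have hAc : ContinuousOn A (Icc (z - H) t₁) := hA.continuousOn hT
  -- The bound is self-referential, so a strict version with a barrier is proved by a
  -- first-violation argument; then `ε` tends to 0.
  suffices hmain : ∀ ε > 0, chordExcess x A t s < ε * Real.exp (13 * A t) by
    have h1 : chordExcess x A t s ≤ 0 := by
      refine le_of_forall_pos_lt_add fun ε hε => ?_
      have := hmain (ε / Real.exp (13 * A t)) (by positivity)
      rw [div_mul_cancel₀ _ (Real.exp_pos _).ne'] at this
      linarith
    simp only [chordExcess] at h1
    linarith
  intro ε hε
  by_contra! hcon
  set Q : Set (ℝ × ℝ) := (Icc z t₁ ×ˢ Icc (z - H) t₁) ∩ {p | p.2 ≤ p.1} with hQ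
  have hQc : IsCompact Q :=
    (isCompact_Icc.prod isCompact_Icc).inter_right (isClosed_le continuous_snd continuous_fst)
  have hQ1 : MapsTo Prod.fst Q (Icc (z - H) t₁) := fun p hp => ⟨by linarith [hp.1.1.1], hp.1.1.2⟩
  have hQ2 : MapsTo Prod.snd Q (Icc (z - H) t₁) := fun p hp => hp.1.2
  have hA1 : ContinuousOn (fun p : ℝ × ℝ => A p.1) Q := hAc.comp continuousOn_fst hQ1
  have hFc : ContinuousOn (fun p : ℝ × ℝ => chordExcess x A p.1 p.2 - ε * Real.exp (13 * A p.1)) Q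
      := by
    have := chordExcess_continuousOn hxc hAc hQ1 hQ2
    fun_prop
  have hbad : IsCompact (Q ∩ (fun p : ℝ × ℝ => chordExcess x A p.1 p.2 - ε * Real.exp (13 * A p.1))
      ⁻¹' Ici 0) :=
    hQc.of_isClosed_subset (hFc.preimage_isClosed_of_isClosed hQc.isClosed isClosed_Ici)
      inter_subset_left
  -- The earliest right endpoint `t'` of a violating chord: all chords ending in `[z, t')` obey the
  -- perturbed bound.
  obtain ⟨⟨t', s'⟩, ⟨⟨⟨⟨ht'1, ht'2⟩, hs'1, -⟩, hs't' : s' ≤ t'⟩, hviol⟩, hmin⟩ :=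
    hbad.exists_isMinOn ⟨(t, s), ⟨⟨⟨ht, hs.1, hs.2.trans ht.2⟩, hs.2⟩, by simpa using hcon⟩⟩
      continuousOn_fst
  have hviol : ε * Real.exp (13 * A t') ≤ chordExcess x A t' s' := by simpa using hviol
  have hbefore : ∀ r ∈ Ico z t', ∀ u ∈ Icc (z - H) r, chordExcess x A r u < ε * Real.exp (13 * A r)
      := by
    intro r hr u hu
    by_contra! hcon
    have hrt : r ≤ t₁ := hr.2.le.trans ht'2
    have h3 : t' ≤ r := isMinOn_iff.1 hmin (r, u) ⟨⟨⟨⟨hr.1, hrt⟩, hu.1, hu.2.trans hrt⟩, hu.2⟩,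
      by simpa using hcon⟩
    exact absurd hr.2 h3.not_gt
  -- A chord ending at `z` has slope at most `1 = slopeBound 0`; if `s'` comes after `z`, the chord
  -- starts degenerate.
  have hstart : chordExcess x A (max s' z) s' ≤ 0 := by
    rcases le_total s' z with hsz | hsz
    · have := hA.sub_le (V := 1) (hx.mono hs'1) (hT.trans hs'1) hsz
        fun r hr => hV r ⟨by linarith [hr.1], by linarith [hr.2]⟩
      rw [max_eq_right hsz]
      simp only [chordExcess, hz, sub_self, slopeBound_zero]
      linarith
    · rw [max_eq_left hsz]
      simp [chordExcess]
  -- After the last zero `b` the excess is positive, so `K * Δ < x r - x s' ≤ w + 171/125`. This is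
  -- the hypothesis needed to show that excess minus barrier decreases, contradicting the violation
  -- at `t'`.
  obtain ⟨b, ⟨hb1, hb2⟩, hFb, hFpos⟩ := exists_last_le (f := fun r => chordExcess x A r s') (c := 0)
    (max_le hs't' ht'1)
    (ContinuousOn.comp (chordExcess_continuousOn hxc hAc hQ1 hQ2)
      (f := fun r => (r, s')) (by fun_prop) fun r hr =>
      ⟨⟨⟨(le_max_right _ _).trans hr.1, hr.2.trans ht'2⟩, hs'1, hs't'.trans ht'2⟩,
        (le_max_left _ _).trans hr.1⟩)
    hstart (lt_of_lt_of_le (by positivity) hviol)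
  have hs'b : s' ≤ b := (le_max_left _ _).trans hb1
  have hzb : z ≤ b := (le_max_right _ _).trans hb1
  have hTb : T ≤ b := by linarith
  have hxac := hx.absCont' (b := b) (c := t') (by linarith) hb2.le
  have hAac := hA.absCont b t' hTb hb2.le
  have hdec := le_of_ae_hasDerivAt_nonpos
    (f := fun r => chordExcess x A r s' - ε * Real.exp (13 * A r)) hb2.le
    ((chordExcess_absolutelyContinuous hxac hAac s').fun_sub (absolutelyContinuous_comp
      (g := fun v => ε * Real.exp (13 * v)) (by fun_prop) hAac)) ?_
  · have h5 : 0 < ε * Real.exp (13 * A b) := by positivity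
    linarith
  filter_upwards [hA.ae, hx.ae] with r h1 h2 hr
  have hzr : z ≤ r := hzb.trans hr.1.le
  have hrt : r ≤ t₁ := hr.2.le.trans ht'2
  obtain ⟨hd, hS, hk, havg⟩ := h1 (hTb.trans hr.1.le)
  have hxd := h2 (by linarith)
  refine ⟨_, ?_, (chordExcess_hasDerivAt hxd hd s').fun_sub (((hd.const_mul 13).exp).const_mul ε)⟩
  have hlow := hzt r ⟨hzr, hrt⟩
  have hup := (abs_le.1 (hV r ⟨by linarith, hrt⟩)).2
  have hs'low := (abs_le.1 (hV s' ⟨by linarith, by linarith⟩)).1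
  have hpos : 0 < chordExcess x A r s' :=
    hFpos r ⟨hr.1, hr.2.le⟩
  simp only [chordExcess] at hpos
  have := chord_derivative_nonpos (w := x r - 46 / 125) (W := ε * Real.exp (13 * A r))
    (S := ∑ k, a k r) (X := -∑ k, a k r * x (h k r)) (Δ := A r - A s') (by linarith) (by linarith)
    (by positivity) (hA.pos.le.trans hS)
    (sub_nonneg.2 (hA.mono (show T ≤ s' by linarith) (show T ≤ r by linarith) (by linarith [hr.1])))
    (by linarith) ?_
  · linarith
  have hterm : ∑ k, a k r * (x r - slopeBound (x r - 46 / 125) * (A r - A (h k r))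
      - ε * Real.exp (13 * A r)) ≤ ∑ k, a k r * x (h k r) := by
    refine Finset.sum_le_sum fun k _ => mul_le_mul_of_nonneg_left ?_ (hk k).1
    have := hbefore r ⟨hzr, hr.2⟩ (h k r) ⟨by linarith [(hk k).2.1], (hk k).2.2⟩
    simp only [chordExcess] at this
    linarith
  have hsplit : ∑ k, a k r * (x r - slopeBound (x r - 46 / 125) * (A r - A (h k r))
      - ε * Real.exp (13 * A r)) = (∑ k, a k r) * (x r - ε * Real.exp (13 * A r))
      - slopeBound (x r - 46 / 125) * ∑ k, a k r * (A r - A (h k r)) := by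
    rw [Finset.sum_mul, Finset.mul_sum, ← Finset.sum_sub_distrib]
    exact Finset.sum_congr rfl fun k _ => by ring
  have hKpos := half_le_slopeBound (w := x r - 46 / 125) (by linarith) (by linarith)
  have := mul_le_mul_of_nonneg_left havg (show 0 ≤ slopeBound (x r - 46 / 125) by linarith)
  linarith

/-- A solution bounded by `1` that has been below `46 / 125` stays below `999 / 1000`. -/
theorem RegularFrom.overshoot_le_one (hA : RegularFrom a h A α H T) {z t₁ : ℝ}
    (hx : SolvesFrom a h x (z - H)) (hT : T ≤ z - H) (hzt : z ≤ t₁)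
    (hV : ∀ r ∈ Icc (z - 2 * H) t₁, |x r| ≤ 1) (hz : x z ≤ 46 / 125) : x t₁ ≤ 999 / 1000 := by
  have hH := hA.delay_nonneg
  by_contra! hcon
  obtain ⟨b, ⟨hzb, hbt⟩, hxb, hb⟩ :=
    exists_last_le hzt (hx.continuousOn (by linarith)) hz (by linarith)
  have hb' : ∀ r ∈ Icc b t₁, 46 / 125 ≤ x r := by
    intro r hr
    rcases hr.1.eq_or_lt with rfl | h1
    · exact hxb.ge
    · exact (hb r ⟨h1, hr.2⟩).le
  -- After `c` the solution lies above `999/1000`, where its derivative is nonpositive, so it cannot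
  -- have risen.
  obtain ⟨c, ⟨hbc, hct⟩, hxc, hc⟩ := exists_last_le (c := 999 / 1000) hbt.le
    (hx.continuousOn (by linarith)) (by linarith) hcon
  have := le_of_ae_hasDerivAt_nonpos hct.le (hx.absCont' (by linarith) hct.le) ?_
  · linarith
  filter_upwards [hA.ae, hx.ae] with r h1 h2 hr
  have hbr : b ≤ r := hbc.trans hr.1.le
  obtain ⟨hd, hS, hk, havg⟩ := h1 (by linarith)
  refine ⟨_, ?_, h2 (by linarith)⟩
  have hup := (abs_le.1 (hV r ⟨by linarith, hr.2.le⟩)).2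
  have hlow := hc r ⟨hr.1, hr.2.le⟩
  have hterm : ∑ k, a k r * (x r - slopeBound (x r - 46 / 125) * (A r - A (h k r)))
      ≤ ∑ k, a k r * x (h k r) := by
    refine Finset.sum_le_sum fun k _ => mul_le_mul_of_nonneg_left ?_ (hk k).1
    have := hA.chord_le (hx.mono (by linarith)) (by linarith)
      (fun u hu => hV u ⟨by linarith [hu.1], hu.2⟩) hxb hb' (t := r) (s := h k r) ⟨hbr, hr.2.le⟩
      ⟨by linarith [(hk k).2.1], (hk k).2.2⟩
    linarith
  have hsplit : ∑ k, a k r * (x r - slopeBound (x r - 46 / 125) * (A r - A (h k r)))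
      = (∑ k, a k r) * x r
      - slopeBound (x r - 46 / 125) * ∑ k, a k r * (A r - A (h k r)) := by
    rw [Finset.sum_mul, Finset.mul_sum, ← Finset.sum_sub_distrib]
    exact Finset.sum_congr rfl fun k _ => by ring
  have hKpos := half_le_slopeBound (w := x r - 46 / 125) (by linarith) (by linarith)
  have hKle := slopeBound_le_of_ge (w := x r - 46 / 125) (by linarith) (by linarith)
  have h6 := mul_le_mul_of_nonneg_left havg (show 0 ≤ slopeBound (x r - 46 / 125) by linarith)
  have h7 := mul_le_mul_of_nonneg_left hKle (hA.pos.le.trans hS)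
  linarith

theorem RegularFrom.overshoot_le (hA : RegularFrom a h A α H T) {z t₁ V : ℝ} (hV0 : 0 < V)
    (hx : SolvesFrom a h x (z - H)) (hT : T ≤ z - H) (hzt : z ≤ t₁)
    (hV : ∀ r ∈ Icc (z - 2 * H) t₁, |x r| ≤ V) (hz : x z ≤ 0) : x t₁ ≤ 999 / 1000 * V := by
  have := hA.overshoot_le_one (hx.const_mul V⁻¹) hT hzt (fun r hr => ?_) ?_
  · rw [inv_mul_le_iff₀ hV0] at this
    linarith
  · rw [abs_mul, abs_of_pos (inv_pos.2 hV0), inv_mul_le_iff₀ hV0, mul_one]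
    exact hV r hr
  · have : V⁻¹ * x z ≤ 0 := mul_nonpos_of_nonneg_of_nonpos (inv_pos.2 hV0).le hz
    linarith

/-! ### Contraction: overshoot or monotone decay -/

/-- A solution decreases as long as it is positive on the interval of the delays. -/
theorem RegularFrom.le_of_pos (hA : RegularFrom a h A α H T) (hx : SolvesFrom a h x s)
    (hT : T ≤ s) (hst : s ≤ t) (hpos : ∀ r ∈ Icc (s - H) t, 0 ≤ x r) : x t ≤ x s := by
  refine le_of_ae_hasDerivAt_nonpos hst (hx.absCont t hst) ?_
  filter_upwards [hA.ae, hx.ae] with r h1 h2 hr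
  obtain ⟨-, -, hk, -⟩ := h1 (hT.trans hr.1.le)
  refine ⟨_, neg_nonpos.2 (Finset.sum_nonneg fun k _ => mul_nonneg (hk k).1 ?_), h2 hr.1.le⟩
  exact hpos _ ⟨by linarith [(hk k).2.1, hr.1], (hk k).2.2.trans hr.2.le⟩

/-- A nonpositive value at some `z ≥ s + 2 * H` triggers the overshoot bound, which looks back by `2
* H`. -/
theorem RegularFrom.le_or_pos (hA : RegularFrom a h A α H T) (hx : SolvesFrom a h x s) {V : ℝ}
    (hV0 : 0 < V) (hT : T ≤ s) (hV : ∀ r ∈ Icc s t, |x r| ≤ V) :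
    x t ≤ 999 / 1000 * V ∨ ∀ r ∈ Icc (s + 2 * H) t, 0 < x r := by
  have hH := hA.delay_nonneg
  refine or_iff_not_imp_right.2 fun hneg => ?_
  push Not at hneg
  obtain ⟨z, hz, hxz⟩ := hneg
  exact hA.overshoot_le hV0 (hx.mono (by linarith [hz.1])) (by linarith [hz.1]) hz.2
    (fun r hr => hV r ⟨by linarith [hr.1, hz.1], hr.2⟩) hxz

theorem RegularFrom.le_max (hA : RegularFrom a h A α H T) (hx : SolvesFrom a h x s) {V : ℝ}
    (hV0 : 0 < V) (hT : T ≤ s) (hst : s + 3 * H ≤ t) (hV : ∀ r ∈ Icc s t, |x r| ≤ V) :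
    x t ≤ max (999 / 1000 * V) (x (s + 3 * H)) := by
  have hH := hA.delay_nonneg
  rcases hA.le_or_pos hx hV0 hT hV with h1 | h1
  · exact h1.trans (le_max_left _ _)
  · refine le_trans ?_ (le_max_right _ _)
    exact hA.le_of_pos (hx.mono (by linarith)) (by linarith) hst
      fun r hr => (h1 r ⟨by linarith [hr.1], hr.2⟩).le

/-- A bound on an interval of thrice the length of the delays is a bound for ever. -/
theorem RegularFrom.abs_le_of_abs_le (hA : RegularFrom a h A α H T) (hx : SolvesFrom a h x s)
    {V : ℝ} (hV0 : 0 < V) (hT : T ≤ s) (hV : ∀ r ∈ Icc s (s + 3 * H), |x r| ≤ V) (hst : s ≤ t) :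
    |x t| ≤ V := by
  have hH := hA.delay_nonneg
  by_contra! hcon
  have ht : s + 3 * H ≤ t := by
    by_contra! h1
    exact absurd (hV t ⟨hst, h1.le⟩) hcon.not_ge
  have hc : ContinuousOn (fun r => |x r|) (Icc s t) := (hx.continuousOn le_rfl).abs
  -- At the first time `z` reaching the height `|x t|`, this height bounds the past, so `le_max` for
  -- `x` and `-x` gives `|x z| < |x t|`.
  obtain ⟨z, hz, hxz, hbefore⟩ := exists_first_ge (f := fun r => |x r|) (g := fun _ => |x t|) ht
    (hc.mono (Icc_subset_Icc_left (by linarith))) continuousOn_const le_rfl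
  have hbd : ∀ r ∈ Ico s z, |x r| ≤ |x t| := by
    intro r hr
    rcases le_total r (s + 3 * H) with h1 | h1
    · exact (hV r ⟨hr.1, h1⟩).trans hcon.le
    · exact (hbefore r ⟨h1, hr.2⟩).le
  have hsz : s + 3 * H < z := by
    refine lt_of_le_of_ne hz.1 ?_
    rintro rfl
    exact absurd (hxz.trans (hV _ ⟨by linarith, le_rfl⟩)) hcon.not_ge
  have hzeq : |x z| ≤ |x t| := by
    have hcl : IsClosed (Icc s z ∩ (fun r => |x r|) ⁻¹' Iic |x t|) :=
      (hc.mono (Icc_subset_Icc_right hz.2)).preimage_isClosed_of_isClosed isClosed_Icc isClosed_Iic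
    have hsub : closure (Ico s z) ⊆ Icc s z ∩ (fun r => |x r|) ⁻¹' Iic |x t| :=
      closure_minimal (fun r hr => ⟨⟨hr.1, hr.2.le⟩, hbd r hr⟩) hcl
    rw [closure_Ico (by linarith)] at hsub
    exact (hsub ⟨by linarith, le_rfl⟩).2
  have hbd' : ∀ r ∈ Icc s z, |x r| ≤ |x t| := by
    intro r hr
    rcases hr.2.eq_or_lt with rfl | h1
    · exact hzeq
    · exact hbd r ⟨hr.1, h1⟩
  have hpos : 0 < |x t| := hV0.trans hcon
  have h3 := abs_le.1 (hV (s + 3 * H) ⟨by linarith, le_rfl⟩)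
  have h1 := hA.le_max hx hpos hT hz.1 hbd'
  have h2 := hA.le_max hx.neg hpos hT hz.1 (by simpa using hbd')
  have h4 : |x z| < |x t| := by
    refine abs_lt.2 ⟨?_, h1.trans_lt (max_lt (by linarith) (by linarith))⟩
    have h5 : -x z < |x t| := h2.trans_lt (max_lt (by linarith) (by linarith))
    linarith
  exact absurd hxz h4.not_ge

/-- In the positive case `x` decreases from `s + 3 * H` on, so after `s + 4 * H` all delayed values
are at least `x t` and `x' ≤ -α * x t`. Over a time `2 / α` this costs `2 * x t`, hence `3 * x t ≤
V`. -/
theorem RegularFrom.decay_upper (hA : RegularFrom a h A α H T) (hx : SolvesFrom a h x s) {V : ℝ}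
    (hV0 : 0 < V) (hT : T ≤ s) (hst : s + (4 * H + 2 / α) ≤ t) (hV : ∀ r ∈ Icc s t, |x r| ≤ V) :
    x t ≤ 999 / 1000 * V := by
  have hH := hA.delay_nonneg
  have hα := hA.pos
  have h2α : 0 < 2 / α := by positivity
  rcases hA.le_or_pos hx hV0 hT hV with h1 | hpos
  · exact h1
  have hanti : ∀ u ∈ Icc (s + 3 * H) t, x t ≤ x u := fun u hu =>
    hA.le_of_pos (hx.mono (by linarith [hu.1])) (by linarith [hu.1]) hu.2
      fun r hr => (hpos r ⟨by linarith [hr.1, hu.1], hr.2⟩).le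
  have hxt : 0 < x t := hpos t ⟨by linarith, le_rfl⟩
  have hst' : s + 4 * H ≤ t := by linarith
  have hxac := hx.absCont' (b := s + 4 * H) (by linarith) hst'
  have hdec := le_of_ae_hasDerivAt_nonpos (f := fun r => x r + x t * α * r) hst'
    (hxac.fun_add (ContDiffOn.absolutelyContinuousOnInterval (by fun_prop))) ?_
  · have h5 := (abs_le.1 (hV (s + 4 * H) ⟨by linarith, hst'⟩)).2
    have h6 : x t * 2 ≤ x t * α * (t - (s + 4 * H)) := by
      rw [mul_assoc]
      refine mul_le_mul_of_nonneg_left ?_ hxt.le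
      rw [mul_comm, ← div_le_iff₀ hα]
      linarith
    linarith
  filter_upwards [hA.ae, hx.ae] with r h1 h2 hr
  obtain ⟨-, hS, hk, -⟩ := h1 (by linarith [hr.1])
  refine ⟨_, ?_, (h2 (by linarith [hr.1])).fun_add ((hasDerivAt_id r).const_mul (x t * α))⟩
  have h7 : (∑ k, a k r) * x t ≤ ∑ k, a k r * x (h k r) := by
    rw [Finset.sum_mul]
    exact Finset.sum_le_sum fun k _ => mul_le_mul_of_nonneg_left
      (hanti _ ⟨by linarith [(hk k).2.1, hr.1], (hk k).2.2.trans hr.2.le⟩) (hk k).1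
  have h8 := mul_le_mul_of_nonneg_right hS hxt.le
  linarith

/-! ### Iteration to exponential decay -/

theorem RegularFrom.abs_le_pow (hA : RegularFrom a h A α H T) {V : ℝ} (hV0 : 0 < V) (n : ℕ) :
    ∀ {s t : ℝ}, SolvesFrom a h x s → T ≤ s → (∀ r, s ≤ r → |x r| ≤ V) →
      s + n * (4 * H + 2 / α) ≤ t → |x t| ≤ (999 / 1000) ^ n * V := by
  have hH := hA.delay_nonneg
  have h2α : 0 < 2 / α := div_pos two_pos hA.pos
  induction n generalizing V with
  | zero =>
    intro s t hx hT hV ht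
    simpa using hV t (by simpa using ht)
  | succ n ih =>
    intro s t hx hT hV ht
    have := ih (V := 999 / 1000 * V) (by positivity)
      (hx.mono (show s ≤ s + (4 * H + 2 / α) by linarith)) (by linarith) ?_
      (t := t) (by push_cast at ht; linarith)
    · calc |x t| ≤ _ := this
        _ = _ := by ring
    intro r hr
    have h1 := hA.decay_upper hx hV0 hT hr fun u hu => hV u hu.1
    have h2 := hA.decay_upper hx.neg hV0 hT hr fun u hu => by simpa using hV u hu.1
    exact abs_le.2 ⟨by linarith, h1⟩

theorem RegularFrom.abs_le_exp (hA : RegularFrom a h A α H T) {V P : ℝ} (hV0 : 0 < V)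
    (hP : P = 4 * H + 2 / α) (hx : SolvesFrom a h x s) (hT : T ≤ s)
    (hV : ∀ r ∈ Icc s (s + 3 * H), |x r| ≤ V) (hst : s ≤ t) :
    |x t| ≤ V * Real.exp (-Real.log (999 / 1000) / P * (P - (t - s))) := by
  have hH := hA.delay_nonneg
  have h2α : 0 < 2 / α := div_pos two_pos hA.pos
  have hP0 : 0 < P := by linarith
  have hn := Nat.floor_le (div_nonneg (sub_nonneg.2 hst) hP0.le)
  have hn' := (Nat.lt_floor_add_one ((t - s) / P)).le
  rw [le_div_iff₀ hP0] at hn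
  have := hA.abs_le_pow hV0 ⌊(t - s) / P⌋₊ hx hT (t := t)
    (fun r hr => hA.abs_le_of_abs_le hx hV0 hT hV hr) (by rw [← hP]; linarith)
  refine this.trans ?_
  rw [mul_comm]
  refine mul_le_mul_of_nonneg_left ?_ hV0.le
  rw [← Real.rpow_natCast, Real.rpow_def_of_pos (by norm_num)]
  refine Real.exp_le_exp.2 ?_
  have hlog : Real.log (999 / 1000) ≤ 0 := Real.log_nonpos (by norm_num) (by norm_num)
  have : -Real.log (999 / 1000) / P * (P - (t - s))
      = Real.log (999 / 1000) * ((t - s) / P - 1) := by field_simp; ring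
  rw [this]
  exact mul_le_mul_of_nonpos_left (by linarith) hlog

/-! ### Growth on the initial stretch -/

/-- A priori growth estimate. -/
theorem abs_le_exp_of_sum_le {B N : ℝ} (hB : 0 ≤ B) (hN : 0 ≤ N) (hx : SolvesFrom a h x s)
    (hxN : ∀ r ≤ s, |x r| ≤ N)
    (hae : ∀ᵐ t, s ≤ t → (∀ k, 0 ≤ a k t ∧ h k t ≤ t) ∧ ∑ k, a k t ≤ B) (hst : s ≤ t) :
    |x t| ≤ N * Real.exp (B * (t - s)) := by
  suffices hmain : ∀ N' > N, |x t| ≤ N' * Real.exp (B * (t - s)) by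
    refine le_of_forall_pos_le_add fun ε hε => ?_
    have := hmain (N + ε / Real.exp (B * (t - s))) (by
      have : 0 < ε / Real.exp (B * (t - s)) := by positivity
      linarith)
    rwa [add_mul, div_mul_cancel₀ _ (Real.exp_pos _).ne'] at this
  -- Taking `N' > N` makes the comparison strict at time `s`, so a first contact is contradictory.
  intro N' hN'
  by_contra! hcon
  have hN0 : 0 < N' := hN.trans_lt hN'
  have hc : ContinuousOn (fun r => |x r|) (Icc s t) := (hx.continuousOn le_rfl).abs
  obtain ⟨z, hz, hxz, hbefore⟩ := exists_first_ge (f := fun r => |x r|)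
    (g := fun r => N' * Real.exp (B * (r - s))) hst hc (by fun_prop) hcon.le
  have hone : ∀ r, s ≤ r → 1 ≤ Real.exp (B * (r - s)) := fun r hr =>
    Real.one_le_exp (mul_nonneg hB (sub_nonneg.2 hr))
  have hupper : ∀ y : ℝ → ℝ, SolvesFrom a h y s → (∀ r, |y r| = |x r|) →
      y z < N' * Real.exp (B * (z - s)) := by
    intro y hy hyx
    have hac := (hy.absCont z hz.1).fun_sub (ContDiffOn.absolutelyContinuousOnInterval
      (f := fun r => N' * Real.exp (B * (r - s))) (by fun_prop))
    have hdec := le_of_ae_hasDerivAt_nonpos hz.1 hac ?_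
    · have h1 := (le_abs_self _).trans ((hyx s).trans_le (hxN s le_rfl))
      simp only [sub_self, mul_zero, Real.exp_zero, mul_one] at hdec
      linarith
    filter_upwards [hae, hy.ae] with r h1 h2 hr
    obtain ⟨hk, hS⟩ := h1 hr.1.le
    refine ⟨_, ?_, (h2 hr.1.le).fun_sub
      (((((hasDerivAt_id r).sub_const s).const_mul B).exp).const_mul N')⟩
    have hE := Real.exp_pos (B * (r - s))
    have hterm : ∑ k, a k r * (-(N' * Real.exp (B * (r - s)))) ≤ ∑ k, a k r * y (h k r) := by
      refine Finset.sum_le_sum fun k _ => mul_le_mul_of_nonneg_left ?_ (hk k).1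
      refine (abs_le.1 ?_).1
      rw [hyx]
      rcases le_total (h k r) s with h3 | h3
      · nlinarith [hxN _ h3, hone r hr.1.le]
      · refine (hbefore _ ⟨h3, (hk k).2.trans_lt hr.2⟩).le.trans ?_
        have := (hk k).2
        gcongr
    rw [← Finset.sum_mul] at hterm
    have := mul_le_mul_of_nonneg_right hS (mul_pos hN0 hE).le
    simp only [id, mul_one] at *
    linarith
  have h1 := hupper x hx fun _ => rfl
  have h2 := hupper _ hx.neg fun _ => abs_neg _
  exact absurd hxz (abs_lt.2 ⟨by linarith, h1⟩).not_ge

/-! ### From essential limits to uniform bounds -/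

theorem eventually_essAtTop {p : ℝ → Prop} (hp : ∀ᶠ t in essAtTop, p t) :
    ∃ T, ∀ᵐ t, T ≤ t → p t := by
  obtain ⟨s, hs, u, hu, hsu⟩ := eventually_inf.1 hp
  obtain ⟨T, hT⟩ := mem_atTop_sets.1 hs
  refine ⟨T, ?_⟩
  filter_upwards [hu] with t ht hTt using hsu t ⟨hT t hTt, ht⟩

theorem ae_of_ae_restrict_Ici {p : ℝ → Prop} (hp : ∀ᵐ t ∂(volume.restrict (Ici (0 : ℝ))), p t) :
    ∀ᵐ t, 0 ≤ t → p t :=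
  (ae_restrict_iff' measurableSet_Ici).1 hp

theorem exists_sum_le (ha : ∀ k, MemLp (a k) ⊤ (volume.restrict (Ici 0))) :
    ∃ B, 0 ≤ B ∧ ∀ᵐ t, 0 ≤ t → ∑ k, a k t ≤ B := by
  have hS : MemLp (fun t => ∑ k, a k t) ⊤ (volume.restrict (Ici 0)) :=
    memLp_finsetSum _ fun k _ => ha k
  refine ⟨(eLpNormEssSup (fun t => ∑ k, a k t) (volume.restrict (Ici 0))).toReal,
    ENNReal.toReal_nonneg, ae_of_ae_restrict_Ici ?_⟩
  filter_upwards [ae_le_eLpNormEssSup (f := fun t => ∑ k, a k t)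
    (μ := volume.restrict (Ici 0))] with t ht
  have h1 := hS.eLpNorm_lt_top
  rw [eLpNorm_exponent_top] at h1
  have h2 := ENNReal.toReal_mono h1.ne ht
  rw [toReal_enorm] at h2
  exact (le_abs_self _).trans h2

theorem intervalIntegrable_sum (ha : ∀ k, MemLp (a k) ⊤ (volume.restrict (Ici 0))) {s t : ℝ}
    (hs : 0 ≤ s) (ht : 0 ≤ t) : IntervalIntegrable (fun t => ∑ k, a k t) volume s t := by
  have hS : MemLp (fun t => ∑ k, a k t) ⊤ (volume.restrict (Ici 0)) :=
    memLp_finsetSum _ fun k _ => ha k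
  have : IsFiniteMeasure (volume.restrict (uIoc s t)) := by unfold uIoc; infer_instance
  refine intervalIntegrable_iff.2 (MemLp.integrable (q := ⊤) le_top
    (hS.mono_measure (Measure.restrict_mono (fun r hr => (le_min hs ht).trans hr.1.le) le_rfl)))

/-- From some time on, the assumptions on the coefficients and on the delays hold uniformly. -/
theorem exists_regularFrom (ha : ∀ k, MemLp (a k) ⊤ (volume.restrict (Ici 0)))
    (hle : ∀ k, ∀ᵐ t ∂(volume.restrict (Ici 0)), h k t ≤ t)
    (ha_nonneg : ∀ k, ∀ᵐ t ∂(volume.restrict (Ici 0)), 0 ≤ a k t)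
    (ha_liminf : 0 < liminf (fun t => ((∑ k, a k t : ℝ) : EReal)) essAtTop)
    (hdelay : ∀ k, limsup (fun t => ((t - h k t : ℝ) : EReal)) essAtTop < ⊤)
    (havg : limsup (fun t => ((∑ k, a k t / (∑ i, a i t) * ∫ s in (h k t)..t, ∑ i, a i s : ℝ) :
        EReal)) essAtTop < ((1 + 1 / Real.exp 1 : ℝ) : EReal)) :
    ∃ A α H T, 0 ≤ T ∧ RegularFrom a h A α H T := by
  obtain ⟨α, hα0, hα⟩ := EReal.lt_iff_exists_real_btwn.1 ha_liminf
  obtain ⟨Tα, hTα⟩ := eventually_essAtTop (eventually_lt_of_lt_liminf hα)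
  have hH : ∀ k, ∃ H T, ∀ᵐ t, T ≤ t → t - h k t < H := by
    intro k
    obtain ⟨H, hH, -⟩ := EReal.lt_iff_exists_real_btwn.1 (hdelay k)
    obtain ⟨T, hT⟩ := eventually_essAtTop (eventually_lt_of_limsup_lt hH)
    refine ⟨H, T, ?_⟩
    filter_upwards [hT] with t h1 h2 using EReal.coe_lt_coe_iff.1 (h1 h2)
  choose Hk Tk hHk using hH
  obtain ⟨Ta, hTa⟩ := eventually_essAtTop (eventually_lt_of_limsup_lt havg)
  set H := ∑ k, |Hk k| with hHdef
  have hH0 : 0 ≤ H := Finset.sum_nonneg fun k _ => abs_nonneg _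
  have hHle : ∀ k, Hk k ≤ H := fun k => (le_abs_self _).trans
    (Finset.single_le_sum (f := fun k => |Hk k|) (fun k _ => abs_nonneg _) (Finset.mem_univ k))
  -- Including `H` ensures `h k t ≥ 0` for `t ≥ T`, where `A` is the integral of integrable
  -- coefficients.
  set T := |Tα| + |Ta| + ∑ k, |Tk k| + H with hTdef
  have hTk0 : 0 ≤ ∑ k, |Tk k| := Finset.sum_nonneg fun k _ => abs_nonneg _
  have hTkle : ∀ k, Tk k ≤ T := fun k => by
    have := Finset.single_le_sum (f := fun k => |Tk k|) (fun k _ => abs_nonneg _)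
      (Finset.mem_univ k)
    linarith [le_abs_self (Tk k), abs_nonneg Tα, abs_nonneg Ta]
  have hTαle : Tα ≤ T := by linarith [le_abs_self Tα, abs_nonneg Ta]
  have hTale : Ta ≤ T := by linarith [le_abs_self Ta, abs_nonneg Tα]
  have hHT : H ≤ T := by linarith [abs_nonneg Ta, abs_nonneg Tα]
  have hT0 : 0 ≤ T := hH0.trans hHT
  have hnonneg := ae_of_ae_restrict_Ici (ae_all_iff.2 ha_nonneg)
  have hle' := ae_of_ae_restrict_Ici (ae_all_iff.2 hle)
  have hderiv : ∀ᵐ t, 0 ≤ t →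
      HasDerivAt (fun t => ∫ s in (0 : ℝ)..t, ∑ k, a k s) (∑ k, a k t) t := by
    have h1 : ∀ n : ℕ, ∀ᵐ t : ℝ, t ∈ uIcc (0 : ℝ) n →
        HasDerivAt (fun t => ∫ s in (0 : ℝ)..t, ∑ k, a k s) (∑ k, a k t) t := by
      intro n
      filter_upwards [(intervalIntegrable_sum ha le_rfl n.cast_nonneg).ae_hasDerivAt_integral]
        with t ht hmem using ht hmem 0 left_mem_uIcc
    filter_upwards [ae_all_iff.2 h1] with t ht ht0
    obtain ⟨n, hn⟩ := exists_nat_ge t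
    exact ht n (by rw [uIcc_of_le n.cast_nonneg]; exact ⟨ht0, hn⟩)
  have hsub : ∀ {s t : ℝ}, 0 ≤ s → 0 ≤ t → (∫ r in (0 : ℝ)..t, ∑ k, a k r) -
      ∫ r in (0 : ℝ)..s, ∑ k, a k r = ∫ r in s..t, ∑ k, a k r := fun hs ht =>
    intervalIntegral.integral_interval_sub_left (intervalIntegrable_sum ha le_rfl ht)
      (intervalIntegrable_sum ha le_rfl hs)
  refine ⟨fun t => ∫ s in (0 : ℝ)..t, ∑ k, a k s, α, H, T, hT0, by exact_mod_cast hα0, hH0,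
    fun s t hs hst => ?_, fun s hs t ht hst => ?_, ?_⟩
  · have hs0 : 0 ≤ s := hT0.trans hs
    refine ((intervalIntegrable_sum ha le_rfl
      (hs0.trans hst)).absolutelyContinuousOnInterval_intervalIntegral left_mem_uIcc).mono ?_
    rw [uIcc_of_le hst, uIcc_of_le (hs0.trans hst)]
    exact Icc_subset_Icc_left hs0
  · have hs0 : 0 ≤ s := hT0.trans hs
    rw [← sub_nonneg, hsub hs0 (hT0.trans ht)]
    refine intervalIntegral.integral_nonneg_of_ae_restrict hst
      ((ae_restrict_iff' measurableSet_Icc).2 ?_)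
    filter_upwards [hnonneg] with r h1 hr
    exact Finset.sum_nonneg fun k _ => h1 (hs0.trans hr.1) k
  filter_upwards [hderiv, hTα, ae_all_iff.2 hHk, hTa, hnonneg, hle'] with t h1 h2 h3 h4 h5 h6 hTt
  have ht0 : 0 ≤ t := hT0.trans hTt
  have hS : α < ∑ k, a k t := EReal.coe_lt_coe_iff.1 (h2 (hTαle.trans hTt))
  have hk : ∀ k, t - H ≤ h k t := fun k => by
    linarith [h3 k ((hTkle k).trans hTt), hHle k]
  refine ⟨h1 ht0, hS.le, fun k => ⟨h5 ht0 k, hk k, h6 ht0 k⟩, ?_⟩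
  have hS0 : 0 < ∑ k, a k t := lt_trans (by exact_mod_cast hα0) hS
  have h7 : ∑ k, a k t / (∑ i, a i t) * ∫ s in (h k t)..t, ∑ i, a i s < 1 + 1 / Real.exp 1 :=
    EReal.coe_lt_coe_iff.1 (h4 (hTale.trans hTt))
  -- The only use of `e`: `1/e ≤ 46/125 = 0.368`.
  have h8 : 1 + 1 / Real.exp 1 ≤ 171 / 125 := by
    have h9 : (1 : ℝ) / Real.exp 1 ≤ 46 / 125 := by
      rw [div_le_iff₀ (Real.exp_pos 1)]
      linarith [Real.exp_one_gt_d9]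
    linarith
  have h10 : ∑ k, a k t * ((∫ s in (0 : ℝ)..t, ∑ k, a k s) -
      ∫ s in (0 : ℝ)..(h k t), ∑ k, a k s) = (∑ k, a k t / (∑ i, a i t) *
        ∫ s in (h k t)..t, ∑ i, a i s) * ∑ k, a k t := by
    rw [Finset.sum_mul]
    refine Finset.sum_congr rfl fun k _ => ?_
    rw [hsub (by linarith [hk k]) ht0]
    field_simp
  rw [h10]
  exact mul_le_mul_of_nonneg_right (h7.le.trans h8) hS0.le

theorem IsSolution.solvesFrom {t₀ x₀ : ℝ} {φ : Iio t₀ → ℝ} {x : ℝ → ℝ}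
    (hx : IsSolution a h t₀ φ x₀ x) : SolvesFrom a h x t₀ :=
  ⟨hx.absCont, (ae_restrict_iff' measurableSet_Ici).1 hx.equation⟩

theorem IsSolution.abs_le {t₀ x₀ : ℝ} {φ : Iio t₀ → ℝ} {x : ℝ → ℝ}
    (hx : IsSolution a h t₀ φ x₀ x) (hφ : ∃ C, ∀ s, |φ s| ≤ C) {r : ℝ} (hr : r ≤ t₀) :
    |x r| ≤ |x₀| + ⨆ s, |φ s| := by
  have hφ0 : 0 ≤ ⨆ s, |φ s| := Real.iSup_nonneg fun s => abs_nonneg _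
  rcases hr.eq_or_lt with rfl | h1
  · rw [hx.initial]
    linarith
  · obtain ⟨C, hC⟩ := hφ
    have h2 : |φ ⟨r, h1⟩| ≤ ⨆ s, |φ s| :=
      le_ciSup (f := fun s => |φ s|) ⟨C, by rintro _ ⟨s, rfl⟩; exact hC s⟩ ⟨r, h1⟩
    rw [hx.history ⟨r, h1⟩]
    linarith [abs_nonneg x₀]

end DelayEquation

end

/-! ### Assembly of the uniform estimate -/

theorem lemma7 (m : ℕ) (a h : Fin m → ℝ → ℝ)
    -- standing assumptions: measurable essentially bounded coefficients, measurable retarded arguments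
    (ha : ∀ k, MemLp (a k) ⊤ (volume.restrict (Ici 0)))
    (hh : ∀ k, AEMeasurable (h k) (volume.restrict (Ici 0)))
    (hle : ∀ k, ∀ᵐ t ∂(volume.restrict (Ici 0)), h k t ≤ t)
    -- nonnegative coefficients, their sum separated from zero, bounded delays
    (ha_nonneg : ∀ k, ∀ᵐ t ∂(volume.restrict (Ici 0)), 0 ≤ a k t)
    (ha_liminf : 0 < liminf (fun t => ((∑ k, a k t : ℝ) : EReal)) DelayEquation.essAtTop)
    (hdelay : ∀ k, limsup (fun t => ((t - h k t : ℝ) : EReal)) DelayEquation.essAtTop < ⊤)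
    -- the average delay condition
    (havg : limsup (fun t => ((∑ k, a k t / (∑ i, a i t) * ∫ s in (h k t)..t, ∑ i, a i s : ℝ) :
        EReal)) DelayEquation.essAtTop < ((1 + 1 / Real.exp 1 : ℝ) : EReal)) :
    DelayEquation.ExponentiallyStable a h := by
  obtain ⟨A, α, H, T, hT0, hA⟩ :=
    DelayEquation.exists_regularFrom ha hle ha_nonneg ha_liminf hdelay havg
  obtain ⟨B, hB0, hB⟩ := DelayEquation.exists_sum_le ha
  have hnonneg := DelayEquation.ae_of_ae_restrict_Ici (ae_all_iff.2 ha_nonneg)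
  have hle' := DelayEquation.ae_of_ae_restrict_Ici (ae_all_iff.2 hle)
  have hH := hA.delay_nonneg
  obtain ⟨P, hP⟩ : ∃ P, P = 4 * H + 2 / α := ⟨_, rfl⟩
  have h2α : 0 < 2 / α := div_pos two_pos hA.pos
  have hP0 : 0 < P := by linarith
  obtain ⟨μ, hμ⟩ : ∃ μ, μ = -Real.log (999 / 1000) / P := ⟨_, rfl⟩
  have hμ0 : 0 < μ := by
    rw [hμ]
    exact div_pos (neg_pos.2 (Real.log_neg (by norm_num) (by norm_num))) hP0
  -- The first factor bounds the growth on `[t₀, t₀ + T + 3 * H]`, where decay is not yet available;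
  -- the second pays for starting the decay only at `t₀ + T` and for the rounding to whole periods
  -- `P`.
  refine ⟨Real.exp (B * (T + 3 * H)) * Real.exp (μ * (P + T)), by positivity, μ, hμ0, ?_⟩
  intro t₀ ht₀ φ _ hφ x₀ x hx t ht
  set N := |x₀| + ⨆ s, |φ s| with hN
  have hN0 : 0 ≤ N := (abs_nonneg _).trans (hx.abs_le hφ le_rfl)
  have hsol := hx.solvesFrom
  have hgrow : ∀ r, t₀ ≤ r → r ≤ t₀ + (T + 3 * H) → |x r| ≤ N * Real.exp (B * (T + 3 * H)) := by
    intro r hr hr'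
    refine (DelayEquation.abs_le_exp_of_sum_le hB0 hN0 hsol (fun u hu => hx.abs_le hφ hu) ?_
      hr).trans ?_
    · filter_upwards [hnonneg, hle', hB] with u h1 h2 h3 hu
      have hu0 := ht₀.trans hu
      exact ⟨fun k => ⟨h1 hu0 k, h2 hu0 k⟩, h3 hu0⟩
    · have : r - t₀ ≤ T + 3 * H := by linarith
      gcongr
  have hrw : Real.exp (B * (T + 3 * H)) * Real.exp (μ * (P + T)) * Real.exp (-μ * (t - t₀)) * N
      = N * Real.exp (B * (T + 3 * H)) * Real.exp (μ * (P - (t - (t₀ + T)))) := by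
    rw [show μ * (P - (t - (t₀ + T))) = μ * (P + T) + -μ * (t - t₀) by ring, Real.exp_add]
    ring
  rw [hrw]
  rcases le_total t (t₀ + T) with h1 | h1
  · refine (hgrow t ht (by linarith)).trans (le_mul_of_one_le_right (by positivity) ?_)
    exact Real.one_le_exp (mul_nonneg hμ0.le (by linarith))
  -- The decay estimate needs a positive bound, while `N` may vanish.
  refine le_of_forall_pos_le_add fun ε hε => ?_
  have hE := Real.exp_pos (μ * (P - (t - (t₀ + T))))
  have := hA.abs_le_exp (V := N * Real.exp (B * (T + 3 * H)) +
    ε / Real.exp (μ * (P - (t - (t₀ + T))))) (by positivity) hP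
    (hsol.mono (show t₀ ≤ t₀ + T by linarith)) (by linarith) (fun r hr => ?_) h1
  · rwa [← hμ, add_mul, div_mul_cancel₀ _ hE.ne'] at this
  · have h3 := hgrow r (by linarith [hr.1]) (by linarith [hr.2])
    have : 0 ≤ ε / Real.exp (μ * (P - (t - (t₀ + T)))) := by positivity
    linarith
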